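/- **Setting.** Let $n,m$ be natural numbers, $A\in\mathbb R^{n\times n}$, $B\in\mathbb R^{n\times m}$, $K\in\mathbb R^{m\times n}$, and let $\Delta=(\delta_1,\dots,\delta_n)\in\mathbb R^n$ with $\delta_i>0$ for all $i$. The uniform quantizer $\mathrm q:\mathbb R^n\to\mathbb R^n$ is $$\mathrm q_i(x)=\delta_i\,\operatorname{sign}(x_i)\left\lfloor\frac{|x_i|}{\delta_i}\right\rfloor,\qquad i=1,\dots,n,$$ with $\operatorname{sign}(0)=0$. Put $\Psi(x)=\mathrm q(x)-x$ and $Z(x)=(A+BK)x+BK\,\Psi(x)=Ax+BK\,\mathrm q(x)$. The Krasovskii regularization of a map $X:\mathbb R^n\to\mathbb R^n$ is $$\mathcal K[X](x)=\bigcap_{\delta>0}\overline{\operatorname{co}}\,X(x+\delta\mathbb B),$$ where $\mathbb B$ is the closed Euclidean unit ball and $\overline{\operatorname{co}}$ denotes the closed convex hull. The closed-loop system is the differential inclusion $\dot x\in\mathcal K[Z](x)$. **Solutions.** A solution to $\dot x\in F(x)$ is a function $\phi:\operatorname{dom}\phi\to\mathbb R^n$, where $\operatorname{dom}\phi\subset\mathbb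 R_{\ge0}$ is an interval containing $0$ (possibly reduced to $\{0\}$), that is absolutely continuous on each compact subinterval of $\operatorname{dom}\phi$ and satisfies $\dot\phi(t)\in F(\phi(t))$ for almost all $t\in\operatorname{dom}\phi$. It is maximal if no solution $\psi$ with $\operatorname{dom}\phi\subsetneq\operatorname{dom}\psi$ agrees with $\phi$ on $\operatorname{dom}\phi$, and complete if $\sup\operatorname{dom}\phi=\infty$. **UGAS.** Write $|y|_{\mathcal A}$ for the Euclidean distance from $y$ to a nonempty closed set $\mathcal A\subset\mathbb R^n$. The set $\mathcal A$ is uniformly globally asymptotically stable (UGAS) for $\dot x\in F(x)$ if 1. there is a continuous, strictly increasing, unbounded function $\alpha:\mathbb R_{\ge0}\to\mathbb R_{\ge0}$ with $\alpha(0)=0$ such that every solution $\phi$ satisfies $|\phi(t)|_{\mathcal A}\le\alpha(|\phi(0)|_{\mathcal A})$ for every $t\in\operatorname{dom}\phi$; and 2. every maximal solution is complete, and for every $\varepsilon>0$ and $\mu>0$ there is $T>0$ such that every solution $\phi$ with $|\phi(0)|_{\mathcal A}\le\mu$ satisfies $|\phi(t)|_{\mathcal A}\le\varepsilon$ for every $t\in\operatorname{dom}\phi$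 with $t\ge T$. **Proposition.** Suppose that there are a symmetric positive definite $P\in\mathbb R^{n\times n}$, diagonal positive definite $S_1,S_2\in\mathbb R^{n\times n}$, and a scalar $\tau>0$ such that $$\begin{bmatrix}\operatorname{He}(P(A+BK))+\tau P & PBK-S_2\\ (PBK-S_2)^{\mathsf T} & -S_1-2S_2\end{bmatrix}<0,\qquad \Delta^{\mathsf T}S_1\Delta-\tau\le0,$$ where $\operatorname{He}(M)=M+M^{\mathsf T}$ and $<0$ means negative definite. Then the ellipsoid $$\mathcal E(P)=\{x\in\mathbb R^n: x^{\mathsf T}Px\le1\}$$ is compact, contains the origin, and is UGAS for the closed-loop system $\dot x\in\mathcal K[Z](x)$. -/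

import Mathlib

open MeasureTheory Filter

noncomputable section

namespace QuantizedControl

/-! Differential inclusions `ẋ ∈ F x` and uniform global asymptotic stability. -/

section Inclusion

variable {E : Type*} [NormedAddCommGroup E] [NormedSpace ℝ E]

/-- `φ`, with domain `I`, is a solution to `ẋ ∈ F x`: the domain is an interval of `ℝ≥0`
containing `0`, `φ` is absolutely continuous on every compact subinterval of `I`, and for almost
every `t ∈ I` the derivative of `φ` at `t` exists and lies in `F (φ t)`. The values of `φ` outside
`I` are irrelevant (the endpoints of `I` form a null set). -/
structure IsSolution (F : E → Set E) (I : Set ℝ) (φ : ℝ → E) : Prop where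
  ordConnected : I.OrdConnected
  subset_nonneg : I ⊆ Set.Ici 0
  zero_mem : (0 : ℝ) ∈ I
  absolutelyContinuous : ∀ a ∈ I, ∀ b ∈ I, AbsolutelyContinuousOnInterval φ a b
  deriv_mem : ∀ᵐ t ∂(volume : Measure ℝ), t ∈ I → ∃ v ∈ F (φ t), HasDerivAt φ v t

/-- A solution is maximal if no other solution extends it to a strictly larger domain. -/
def IsMaximalSolution (F : E → Set E) (I : Set ℝ) (φ : ℝ → E) : Prop :=
  IsSolution F I φ ∧
    ¬ ∃ (J : Set ℝ) (ψ : ℝ → E), IsSolution F J ψ ∧ I ⊂ J ∧ Set.EqOn φ ψ I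

/-- Functions of class `𝒦∞` (only the values on `ℝ≥0` matter). -/
structure IsClassKInfty (α : ℝ → ℝ) : Prop where
  continuousOn : ContinuousOn α (Set.Ici 0)
  map_zero : α 0 = 0
  strictMonoOn : StrictMonoOn α (Set.Ici 0)
  unbounded : ∀ M : ℝ, ∃ s : ℝ, 0 ≤ s ∧ M ≤ α s

/-- Global uniform stability of the set `𝒜` for `ẋ ∈ F x`. -/
def GloballyUniformlyStable (F : E → Set E) (𝒜 : Set E) : Prop :=
  ∃ α : ℝ → ℝ, IsClassKInfty α ∧ ∀ (I : Set ℝ) (φ : ℝ → E), IsSolution F I φ →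
    ∀ t ∈ I, Metric.infDist (φ t) 𝒜 ≤ α (Metric.infDist (φ 0) 𝒜)

/-- Uniform global attractivity of the set `𝒜` for `ẋ ∈ F x`; a solution is complete when its
domain is unbounded. -/
def UniformlyGloballyAttractive (F : E → Set E) (𝒜 : Set E) : Prop :=
  (∀ (I : Set ℝ) (φ : ℝ → E), IsMaximalSolution F I φ → ¬ BddAbove I) ∧
  ∀ ε > (0 : ℝ), ∀ μ > (0 : ℝ), ∃ T > (0 : ℝ),
    ∀ (I : Set ℝ) (φ : ℝ → E), IsSolution F I φ → Metric.infDist (φ 0) 𝒜 ≤ μ →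
      ∀ t ∈ I, T ≤ t → Metric.infDist (φ t) 𝒜 ≤ ε

/-- Uniform global asymptotic stability of the set `𝒜` for `ẋ ∈ F x`. -/
def UGAS (F : E → Set E) (𝒜 : Set E) : Prop :=
  GloballyUniformlyStable F 𝒜 ∧ UniformlyGloballyAttractive F 𝒜

/-- The Krasovskii regularization of a vector field `X`. -/
def krasovskii (X : E → E) (x : E) : Set E :=
  ⋂ (δ : ℝ) (_ : 0 < δ), closure (convexHull ℝ (X '' Metric.closedBall x δ))

end Inclusion

/-! The quantized closed loop. -/

/-- The uniform quantizer with steps `δ i`. -/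
def quantizer {n : ℕ} (δ : Fin n → ℝ) (x : EuclideanSpace ℝ (Fin n)) :
    EuclideanSpace ℝ (Fin n) :=
  WithLp.toLp 2 fun i => δ i * Real.sign (x i) * (⌊|x i| / δ i⌋ : ℝ)

/-- The quantization error `Ψ(x) = q(x) - x`. -/
def quantizationError {n : ℕ} (δ : Fin n → ℝ) (x : EuclideanSpace ℝ (Fin n)) :
    EuclideanSpace ℝ (Fin n) :=
  quantizer δ x - x

/-- The right-hand side `(A + B K) x + B K Ψ(x)` of the closed loop. -/
def closedLoop {n m : ℕ} (A : Matrix (Fin n) (Fin n) ℝ) (B : Matrix (Fin n) (Fin m) ℝ)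
    (K : Matrix (Fin m) (Fin n) ℝ) (δ : Fin n → ℝ) (x : EuclideanSpace ℝ (Fin n)) :
    EuclideanSpace ℝ (Fin n) :=
  Matrix.toEuclideanLin (A + B * K) x + Matrix.toEuclideanLin (B * K) (quantizationError δ x)

/-- The closed-loop right-hand side is `A x + B K q(x)`. -/
theorem closedLoop_eq {n m : ℕ} (A : Matrix (Fin n) (Fin n) ℝ) (B : Matrix (Fin n) (Fin m) ℝ)
    (K : Matrix (Fin m) (Fin n) ℝ) (δ : Fin n → ℝ) (x : EuclideanSpace ℝ (Fin n)) :
    closedLoop A B K δ x =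
      Matrix.toEuclideanLin A x + Matrix.toEuclideanLin (B * K) (quantizer δ x) := by
  simp [closedLoop, quantizationError, map_sub, map_add]

/-- `He(M) = M + Mᵀ`. -/
def He {n : ℕ} (M : Matrix (Fin n) (Fin n) ℝ) : Matrix (Fin n) (Fin n) ℝ :=
  M + M.transpose

/-- The symmetric block matrix `[He(P(A+BK)) + τP, PBK - S₂; •, -S₁ - 2S₂]`. -/
def lmiMatrix {n m : ℕ} (A : Matrix (Fin n) (Fin n) ℝ) (B : Matrix (Fin n) (Fin m) ℝ)
    (K : Matrix (Fin m) (Fin n) ℝ) (P S₁ S₂ : Matrix (Fin n) (Fin n) ℝ) (τ : ℝ) :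
    Matrix (Fin n ⊕ Fin n) (Fin n ⊕ Fin n) ℝ :=
  Matrix.fromBlocks (He (P * (A + B * K)) + τ • P) (P * B * K - S₂)
    (P * B * K - S₂).transpose (-S₁ - (2 : ℝ) • S₂)

/-- The ellipsoid `{x | xᵀ P x ≤ 1}`. -/
def ellipsoid {n : ℕ} (P : Matrix (Fin n) (Fin n) ℝ) : Set (EuclideanSpace ℝ (Fin n)) :=
  {x | x.ofLp ⬝ᵥ P.mulVec x.ofLp ≤ 1}

end QuantizedControl

end

/-!
Write `L` for a matrix with `P = Lᵀ L`, so that the ellipsoid is `{x | ‖L x‖ ≤ 1}` and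
`V x = ‖L x‖²` is the quadratic Lyapunov function `xᵀ P x`.

*Dissipation.* The quantization error `ψ` satisfies `|ψ i| ≤ δ i` and `ψ i * (ψ i + x i) ≤ 0`.
Adding these conditions, weighted by `S₁` and `S₂`, to the quadratic form of the matrix inequality
at `(x, ψ)` gives `2 ⟪L x, L (Z x)⟫ ≤ τ (1 - V x)` (`dissipation_of_lmi`). For fixed `x` this bounds
a linear functional of the velocity, with a bound that depends continuously on the base point, so
it holds for every velocity in the Krasovskii regularization (`inner_map_le_of_mem_krasovskii`): a
closed half-space is closed and convex.

*Decay.* Hence `exp (τ t) (V (φ t) - 1)` does not increase along a solution `φ`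
(`exp_mul_le_of_isSolution`). The distance to the ellipsoid is comparable to the positive part of
`‖L x‖ - 1`, which gives stability with a linear gain and uniform attractivity.

*Completeness.* Along a solution `V` is bounded by `max (V (φ 0)) 1`, so a solution on a bounded
interval is Lipschitz and extends continuously to the endpoint. There it is continued by a global
solution (`exists_krasovskii_solution`), constructed as the limit `φ` of Euler schemes along an
ultrafilter. A difference quotient of an Euler scheme is an average of values of the vector field
near the current point, so it lies in a closed convex set containing these values. This survives
the limit (`slope_mem_of_tendsto_euler`), and so `φ' t` lies in the regularization at `φ t` wherever
`φ` is differentiable, which is almost everywhere since `φ` is locally Lipschitz.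
-/

namespace QuantizedControl

open Topology
open scoped RealInnerProductSpace NNReal

/-! ### Absolutely continuous functions -/

section AbsolutelyContinuous

theorem absolutelyContinuousOnInterval_comp_lipschitz {X Y : Type*} [PseudoMetricSpace X]
    [PseudoMetricSpace Y] {φ : ℝ → X} {g : X → Y} {C : ℝ≥0} {a b : ℝ} (hg : LipschitzWith C g)
    (hφ : AbsolutelyContinuousOnInterval φ a b) :
    AbsolutelyContinuousOnInterval (fun t => g (φ t)) a b := by
  refine squeeze_zero (fun t => Finset.sum_nonneg fun i _ => dist_nonneg) (fun t => ?_)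
    (by simpa using Tendsto.const_mul (C : ℝ) hφ)
  rw [Finset.mul_sum]
  exact Finset.sum_le_sum fun i _ => hg.dist_le_mul _ _

theorem sub_le_mul_of_hasDerivAt_le {f : ℝ → ℝ} {a b c : ℝ} (hab : a ≤ b)
    (hf : AbsolutelyContinuousOnInterval f a b)
    (hd : ∀ᵐ t, t ∈ Set.Icc a b → ∃ v ≤ c, HasDerivAt f v t) :
    f b - f a ≤ c * (b - a) := by
  rw [← hf.integral_deriv_eq_sub]
  have : ∫ t in a..b, deriv f t ≤ ∫ _ in a..b, c := by
    refine intervalIntegral.integral_mono_ae_restrict hab hf.intervalIntegrable_deriv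
      intervalIntegrable_const ?_
    filter_upwards [ae_restrict_of_ae hd, ae_restrict_mem measurableSet_Icc] with t ht htm
    obtain ⟨v, hv, hd⟩ := ht htm
    rwa [hd.deriv]
  simpa [mul_comm] using this

variable {E : Type*} [NormedAddCommGroup E] [InnerProductSpace ℝ E]

/-- The mean value inequality for vector-valued absolutely continuous functions; it is reduced to
the scalar one by pairing with the increment itself. -/
theorem norm_sub_le_of_hasDerivAt_norm_le {φ : ℝ → E} {a b M : ℝ} (hab : a ≤ b)
    (hM : 0 ≤ M) (hφ : AbsolutelyContinuousOnInterval φ a b)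
    (hd : ∀ᵐ t, t ∈ Set.Icc a b → ∃ v, ‖v‖ ≤ M ∧ HasDerivAt φ v t) :
    ‖φ b - φ a‖ ≤ M * (b - a) := by
  set u := φ b - φ a with hu
  have hac : AbsolutelyContinuousOnInterval (fun t => ⟪u, φ t⟫) a b :=
    absolutelyContinuousOnInterval_comp_lipschitz (innerSL ℝ u).lipschitz hφ
  have key := sub_le_mul_of_hasDerivAt_le (c := ‖u‖ * M) hab hac (by
    filter_upwards [hd] with t ht htm
    obtain ⟨v, hv, h⟩ := ht htm
    exact ⟨⟪u, v⟫, (real_inner_le_norm u v).trans (by gcongr),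
      (innerSL ℝ u).hasFDerivAt.comp_hasDerivAt t h⟩)
  rw [← inner_sub_right, ← hu, real_inner_self_eq_norm_sq] at key
  by_contra! hlt
  have h0 : 0 < ‖u‖ ∨ ‖u‖ = 0 := (norm_nonneg u).lt_or_eq.imp id Eq.symm
  rcases h0 with h0 | h0
  · nlinarith
  · nlinarith [mul_nonneg hM (sub_nonneg.2 hab)]

end AbsolutelyContinuous

/-! ### Values of the Krasovskii regularization -/

section Krasovskii

variable {E : Type*} [NormedAddCommGroup E] [InnerProductSpace ℝ E]

/-- Linear inequalities on a vector field pass to its Krasovskii regularization, because a closed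
half-space is closed and convex. -/
theorem inner_le_of_mem_krasovskii {X : E → E} {x v w : E} {h : E → ℝ}
    (hX : ∀ y, ⟪w, X y⟫ ≤ h y) (hc : ContinuousAt h x) (hv : v ∈ krasovskii X x) :
    ⟪w, v⟫ ≤ h x := by
  refine le_of_forall_gt_imp_ge_of_dense fun b hb => ?_
  obtain ⟨r, hr, hball⟩ := Metric.mem_nhds_iff.1 (hc.eventually_lt_const hb)
  have hsub : X '' Metric.closedBall x (r / 2) ⊆ {z | ⟪w, z⟫ ≤ b} := by
    rintro _ ⟨y, hy, rfl⟩
    exact (hX y).trans (le_of_lt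
      (hball (Metric.closedBall_subset_ball (by linarith) hy)))
  have hconv : Convex ℝ {z : E | ⟪w, z⟫ ≤ b} :=
    convex_halfSpace_le (innerSL ℝ w).toLinearMap.isLinear b
  have hclosed : IsClosed {z : E | ⟪w, z⟫ ≤ b} :=
    isClosed_le (by fun_prop) continuous_const
  exact closure_minimal (convexHull_min hsub hconv) hclosed
    (Set.mem_iInter₂.1 hv (r / 2) (by linarith))

theorem norm_le_of_mem_krasovskii {X : E → E} {c : ℝ} (hX : ∀ y, ‖X y‖ ≤ c * (1 + ‖y‖)) {x v : E}
    (hv : v ∈ krasovskii X x) : ‖v‖ ≤ c * (1 + ‖x‖) := by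
  have h := inner_le_of_mem_krasovskii (w := v) (h := fun y => ‖v‖ * (c * (1 + ‖y‖)))
    (fun y => (real_inner_le_norm _ _).trans
      (mul_le_mul_of_nonneg_left (hX y) (norm_nonneg v))) (by fun_prop) hv
  rw [real_inner_self_eq_norm_sq, sq] at h
  rcases (norm_nonneg v).eq_or_lt with h0 | h0
  · rw [← h0]
    exact (norm_nonneg _).trans (hX x)
  · exact le_of_mul_le_mul_left h h0

/-- A dissipation inequality satisfied by `X` pointwise is satisfied by every vector of the
regularization of `X`. -/
theorem inner_map_le_of_mem_krasovskii [CompleteSpace E] {X : E → E} {c τ : ℝ} (L : E →L[ℝ] E)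
    (hX : ∀ y, ‖X y‖ ≤ c * (1 + ‖y‖))
    (hL : ∀ y, 2 * ⟪L y, L (X y)⟫ ≤ τ * (1 - ‖L y‖ ^ 2)) {x v : E} (hv : v ∈ krasovskii X x) :
    2 * ⟪L x, L v⟫ ≤ τ * (1 - ‖L x‖ ^ 2) := by
  -- The excess of `⟪L x, L (X y)⟫` over `⟪L y, L (X y)⟫` vanishes as `y → x`, as `X` is locally
  -- bounded.
  have h := inner_le_of_mem_krasovskii (X := X) (x := x) (v := v)
    (w := (2 : ℝ) • ContinuousLinearMap.adjoint L (L x))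
    (h := fun y => τ * (1 - ‖L y‖ ^ 2) + 2 * (‖L (x - y)‖ * (‖L‖ * (c * (1 + ‖y‖)))))
    (fun y => by
      rw [inner_smul_left, ContinuousLinearMap.adjoint_inner_left]
      have h1 : ⟪L x, L (X y)⟫ = ⟪L y, L (X y)⟫ + ⟪L (x - y), L (X y)⟫ := by
        rw [← inner_add_left, ← map_add]; simp
      have h2 : ⟪L (x - y), L (X y)⟫ ≤ ‖L (x - y)‖ * (‖L‖ * (c * (1 + ‖y‖))) :=
        (real_inner_le_norm _ _).trans (mul_le_mul_of_nonneg_left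
          ((L.le_opNorm _).trans (mul_le_mul_of_nonneg_left (hX y) (norm_nonneg _)))
          (norm_nonneg _))
      have := hL y
      simp only [RCLike.conj_to_real]
      linarith)
    (by fun_prop) hv
  rw [inner_smul_left, ContinuousLinearMap.adjoint_inner_left] at h
  simpa using h

/-- Exponential decay of `‖L φ‖² - 1` along a solution. -/
theorem exp_mul_le_of_isSolution {F : E → Set E} {τ : ℝ} (L : E →L[ℝ] E)
    (hF : ∀ x, ∀ v ∈ F x, 2 * ⟪L x, L v⟫ ≤ τ * (1 - ‖L x‖ ^ 2))
    {I : Set ℝ} {φ : ℝ → E} (hφ : IsSolution F I φ) {t : ℝ} (ht : t ∈ I) :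
    Real.exp (τ * t) * (‖L (φ t)‖ ^ 2 - 1) ≤ ‖L (φ 0)‖ ^ 2 - 1 := by
  have ht0 : 0 ≤ t := hφ.subset_nonneg ht
  have hac := hφ.absolutelyContinuous 0 hφ.zero_mem t ht
  have hn : AbsolutelyContinuousOnInterval (fun s => ‖L (φ s)‖) 0 t :=
    absolutelyContinuousOnInterval_comp_lipschitz (g := fun x => ‖L x‖)
      (lipschitzWith_one_norm.comp L.lipschitz) hac
  have he : AbsolutelyContinuousOnInterval (fun s => Real.exp (τ * s)) 0 t :=
    ContDiffOn.absolutelyContinuousOnInterval (ContDiff.contDiffOn (by fun_prop))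
  have h1 : AbsolutelyContinuousOnInterval (fun _ : ℝ => (1 : ℝ)) 0 t :=
    ContDiffOn.absolutelyContinuousOnInterval contDiffOn_const
  have hW := he.fun_mul ((hn.fun_mul hn).fun_sub h1)
  have key := sub_le_mul_of_hasDerivAt_le (c := 0) ht0 hW (by
    filter_upwards [hφ.deriv_mem] with s hs hsm
    obtain ⟨v, hv, hd⟩ := hs (hφ.ordConnected.out hφ.zero_mem ht hsm)
    have hV : HasDerivAt (fun s => ‖L (φ s)‖ * ‖L (φ s)‖ - 1) (2 * ⟪L (φ s), L v⟫) s := by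
      have h := (L.hasFDerivAt.comp_hasDerivAt s hd).norm_sq.sub_const 1
      simp only [sq] at h
      exact h
    have hE : HasDerivAt (fun s => Real.exp (τ * s)) (Real.exp (τ * s) * τ) s := by
      simpa using ((hasDerivAt_id s).const_mul τ).exp
    refine ⟨_, ?_, hE.mul hV⟩
    have h2 := hF _ v hv
    have h3 := Real.exp_pos (τ * s)
    rw [sq] at h2
    nlinarith)
  simpa [sq] using key

end Krasovskii

/-! ### Euler polygons and existence of Krasovskii solutions -/

section Euler

variable {E : Type*} [NormedAddCommGroup E] [NormedSpace ℝ E]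

/-- The nodes of the explicit Euler scheme with step `h` for the vector field `X`. -/
def eulerSeq (X : E → E) (h : ℝ) (x₀ : E) : ℕ → E
  | 0 => x₀
  | j + 1 => eulerSeq X h x₀ j + h • X (eulerSeq X h x₀ j)

variable {X : E → E} {h : ℝ} {x₀ : E}

theorem eulerSeq_sub {p q : ℕ} (hpq : p ≤ q) :
    eulerSeq X h x₀ q - eulerSeq X h x₀ p = h • ∑ j ∈ Finset.Ico p q, X (eulerSeq X h x₀ j) := by
  induction q, hpq using Nat.le_induction with
  | base => simp
  | succ q hq ih =>
    rw [Finset.sum_Ico_succ_top hq, smul_add, ← ih, eulerSeq]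
    abel

theorem norm_eulerSeq_sub_le (hh : 0 ≤ h) {p q : ℕ} (hpq : p ≤ q) {M : ℝ}
    (hM : ∀ j ∈ Finset.Ico p q, ‖X (eulerSeq X h x₀ j)‖ ≤ M) :
    ‖eulerSeq X h x₀ q - eulerSeq X h x₀ p‖ ≤ (q * h - p * h) * M := by
  rw [eulerSeq_sub hpq, norm_smul, Real.norm_of_nonneg hh]
  have := norm_sum_le_of_le _ hM
  rw [Finset.sum_const, Nat.card_Ico, nsmul_eq_mul, Nat.cast_sub hpq] at this
  calc _ ≤ h * (((q : ℝ) - p) * M) := by gcongr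
    _ = _ := by ring

/-- Difference quotients of the Euler nodes are averages of values of `X`. -/
theorem eulerSeq_slope_mem (hh : 0 < h) {p q : ℕ} (hpq : p < q) {C : Set E} (hC : Convex ℝ C)
    (hX : ∀ j ∈ Finset.Ico p q, X (eulerSeq X h x₀ j) ∈ C) :
    ((q : ℝ) * h - p * h)⁻¹ • (eulerSeq X h x₀ q - eulerSeq X h x₀ p) ∈ C := by
  have key := hC.centerMass_mem (t := Finset.Ico p q) (w := fun _ => (1 : ℝ))
    (fun _ _ => zero_le_one) (by simpa using hpq) hX
  convert key using 1
  rw [eulerSeq_sub hpq.le, Finset.centerMass, smul_smul]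
  have : (0 : ℝ) < q - p := sub_pos.2 (by exact_mod_cast hpq)
  simp only [one_smul, Finset.sum_const, Nat.card_Ico, nsmul_eq_mul, Nat.cast_sub hpq.le, mul_one]
  congr 1
  rw [← sub_mul]
  field_simp

/-- A discrete Grönwall bound, uniform in the step at a given time `j * h`. -/
theorem norm_eulerSeq_le {c : ℝ} (hX : ∀ y, ‖X y‖ ≤ c * (1 + ‖y‖)) (hh : 0 ≤ h)
    (j : ℕ) : ‖eulerSeq X h x₀ j‖ ≤ Real.exp (c * (j * h)) * (1 + ‖x₀‖) := by
  suffices H : 1 + ‖eulerSeq X h x₀ j‖ ≤ Real.exp (c * (j * h)) * (1 + ‖x₀‖) by linarith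
  induction j with
  | zero => simp [eulerSeq]
  | succ j ih =>
    have h1 : 1 + ‖eulerSeq X h x₀ (j + 1)‖ ≤ (1 + c * h) * (1 + ‖eulerSeq X h x₀ j‖) := by
      have h2 : ‖eulerSeq X h x₀ (j + 1)‖ ≤
          ‖eulerSeq X h x₀ j‖ + h * (c * (1 + ‖eulerSeq X h x₀ j‖)) := by
        rw [eulerSeq]
        refine (norm_add_le _ _).trans ?_
        rw [norm_smul, Real.norm_of_nonneg hh]
        gcongr
        exact hX _
      linarith
    have h3 : 1 + c * h ≤ Real.exp (c * h) := by linarith [Real.add_one_le_exp (c * h)]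
    have h4 : Real.exp (c * ((j + 1 : ℕ) * h)) = Real.exp (c * h) * Real.exp (c * (j * h)) := by
      rw [← Real.exp_add]; push_cast; ring_nf
    rw [h4, mul_assoc]
    exact h1.trans (mul_le_mul h3 ih (by positivity) (Real.exp_pos _).le)

/-- The step of the `N`-th Euler scheme. -/
noncomputable def eulerStep (N : ℕ) : ℝ := 1 / ((N : ℝ) + 1)

/-- The index of the last node of the `N`-th Euler scheme before time `t`. -/
noncomputable def eulerIndex (N : ℕ) (t : ℝ) : ℕ := ⌊t * ((N : ℝ) + 1)⌋₊

theorem eulerStep_pos (N : ℕ) : 0 < eulerStep N := Nat.one_div_pos_of_nat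

theorem eulerIndex_mul_le {N : ℕ} {t : ℝ} (ht : 0 ≤ t) : eulerIndex N t * eulerStep N ≤ t := by
  rw [eulerStep, mul_one_div, div_le_iff₀ (by positivity)]
  exact Nat.floor_le (by positivity)

theorem lt_eulerIndex_mul {N : ℕ} {t : ℝ} : t < eulerIndex N t * eulerStep N + eulerStep N := by
  rw [eulerStep, mul_one_div, ← add_div, lt_div_iff₀ (by positivity)]
  exact Nat.lt_floor_add_one _

theorem eulerIndex_mono {N : ℕ} {s t : ℝ} (hst : s ≤ t) : eulerIndex N s ≤ eulerIndex N t :=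
  Nat.floor_mono (by gcongr)

theorem tendsto_eulerStep : Tendsto eulerStep atTop (𝓝 0) :=
  tendsto_one_div_add_atTop_nhds_zero_nat

theorem tendsto_eulerIndex_mul {t : ℝ} (ht : 0 ≤ t) :
    Tendsto (fun N => (eulerIndex N t : ℝ) * eulerStep N) atTop (𝓝 t) := by
  refine tendsto_of_tendsto_of_tendsto_of_le_of_le (g := fun N => t - eulerStep N) ?_
    tendsto_const_nhds (fun N => ?_) (fun N => eulerIndex_mul_le ht)
  · simpa using tendsto_eulerStep.const_sub t
  · have := lt_eulerIndex_mul (N := N) (t := t)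
    dsimp only
    linarith

/-- If the velocities of the Euler schemes between the times `s` and `t` lie in a closed convex
set, then so does the difference quotient of a pointwise limit of the schemes. -/
theorem slope_mem_of_tendsto_euler {l : Filter ℕ} [l.NeBot] (hl : l ≤ atTop) {φ : ℝ → E}
    (hφ : ∀ t, Tendsto (fun N => eulerSeq X (eulerStep N) x₀ (eulerIndex N t)) l (𝓝 (φ t)))
    {C : Set E} (hC : Convex ℝ C) (hC' : IsClosed C) {s t : ℝ} (hs : 0 ≤ s) (hst : s < t)
    (hX : ∀ᶠ N in l, ∀ j ∈ Finset.Ico (eulerIndex N s) (eulerIndex N t),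
      X (eulerSeq X (eulerStep N) x₀ j) ∈ C) :
    slope φ s t ∈ C := by
  have hlim := ((tendsto_eulerIndex_mul (hs.trans hst.le)).sub (tendsto_eulerIndex_mul hs))
  have hpos : ∀ᶠ N in l, eulerIndex N s < eulerIndex N t := by
    filter_upwards [hl (hlim.eventually (lt_mem_nhds (sub_pos.2 hst)))] with N hN
    have := (sub_pos.1 hN)
    exact_mod_cast lt_of_mul_lt_mul_right this (eulerStep_pos N).le
  refine hC'.mem_of_tendsto
    (((hlim.mono_left hl).inv₀ (sub_pos.2 hst).ne').smul ((hφ t).sub (hφ s))) ?_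
  filter_upwards [hX, hpos] with N hN hlt
  exact eulerSeq_slope_mem (eulerStep_pos N) hlt hC hN

/-- Global existence for the Krasovskii regularization of a vector field of linear growth. The
solution is a limit of Euler schemes along an ultrafilter; wherever this limit is differentiable,
its derivative is a limit of averages of nearby values of `X`. -/
theorem exists_krasovskii_solution [FiniteDimensional ℝ E] {c : ℝ} (hc : 0 ≤ c)
    (hX : ∀ y, ‖X y‖ ≤ c * (1 + ‖y‖)) (x₀ : E) :
    ∃ φ : ℝ → E, φ 0 = x₀ ∧ (∀ T, ∃ C : ℝ≥0, LipschitzOnWith C φ (Set.Icc 0 T)) ∧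
      ∀ᵐ t, 0 < t → ∃ v ∈ krasovskii X (φ t), HasDerivAt φ v t := by
  have : ProperSpace E := FiniteDimensional.proper_real E
  set 𝒰 : Ultrafilter ℕ := hyperfilter ℕ
  have hl : (𝒰 : Filter ℕ) ≤ atTop := Nat.hyperfilter_le_atTop
  set R : ℝ → ℝ := fun T => Real.exp (c * T) * (1 + ‖x₀‖) with hR
  have hbound : ∀ T N j, 0 ≤ T → j ≤ eulerIndex N T → ‖eulerSeq X (eulerStep N) x₀ j‖ ≤ R T := by
    intro T N j hT hj
    refine (norm_eulerSeq_le hX (eulerStep_pos N).le j).trans ?_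
    have h1 : (j : ℝ) * eulerStep N ≤ T :=
      (mul_le_mul_of_nonneg_right (by exact_mod_cast hj) (eulerStep_pos N).le).trans
        (eulerIndex_mul_le hT)
    simp only [hR]
    gcongr
  have hXbound : ∀ T N j, 0 ≤ T → j ≤ eulerIndex N T →
      ‖X (eulerSeq X (eulerStep N) x₀ j)‖ ≤ c * (1 + R T) := fun T N j hT hj =>
    (hX _).trans (by gcongr; exact hbound T N j hT hj)
  have hex : ∀ t, ∃ y,
      Tendsto (fun N => eulerSeq X (eulerStep N) x₀ (eulerIndex N t)) 𝒰 (𝓝 y) := by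
    intro t
    obtain ⟨y, -, hy⟩ := (isCompact_closedBall (0 : E) (R (max t 0))).ultrafilter_le_nhds
      (𝒰.map fun N => eulerSeq X (eulerStep N) x₀ (eulerIndex N t)) (by
        refine le_principal_iff.2 (Filter.mem_map.2 (Eventually.of_forall fun N => ?_))
        simpa using hbound (max t 0) N _ (le_max_right _ _) (eulerIndex_mono (le_max_left _ _)))
    exact ⟨y, hy⟩
  choose φ hφ using hex
  have hM0 : ∀ T, 0 ≤ c * (1 + R T) := fun T => by positivity
  have hLip : ∀ T, LipschitzOnWith (c * (1 + R T)).toNNReal φ (Set.Icc 0 T) := by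
    intro T
    have key : ∀ s t, 0 ≤ s → s < t → t ≤ T → ‖φ t - φ s‖ ≤ c * (1 + R T) * (t - s) := by
      intro s t hs hst htT
      have h1 := slope_mem_of_tendsto_euler hl hφ (convex_closedBall (0 : E) (c * (1 + R T)))
        Metric.isClosed_closedBall hs hst (Eventually.of_forall fun N j hj => by
          rw [mem_closedBall_zero_iff]
          exact hXbound T N j (hs.trans (hst.le.trans htT))
            ((Finset.mem_Ico.1 hj).2.le.trans (eulerIndex_mono htT)))
      have h2 := sub_pos.2 hst
      rw [mem_closedBall_zero_iff, slope_def_module, norm_smul, norm_inv,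
        Real.norm_of_nonneg h2.le, inv_mul_le_iff₀ h2] at h1
      linarith
    refine LipschitzOnWith.of_dist_le_mul fun s hs t ht => ?_
    rw [Real.coe_toNNReal _ (hM0 T)]
    rcases lt_trichotomy s t with h | rfl | h
    · rw [dist_comm, dist_eq_norm, Real.dist_eq, abs_sub_comm, abs_of_pos (sub_pos.2 h)]
      exact key s t hs.1 h ht.2
    · simp
    · rw [dist_eq_norm, Real.dist_eq, abs_of_pos (sub_pos.2 h)]
      exact key t s ht.1 h hs.2
  refine ⟨φ, ?_, fun T => ⟨_, hLip T⟩, ?_⟩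
  · refine tendsto_nhds_unique (hφ 0) ?_
    simp [eulerIndex, eulerSeq]
  have hdiff : ∀ᵐ t, ∀ T : ℕ, t ∈ Set.Icc (0 : ℝ) T →
      DifferentiableWithinAt ℝ φ (Set.Icc (0 : ℝ) T) t :=
    ae_all_iff.2 fun T => (hLip T).ae_differentiableWithinAt_of_mem_real
  filter_upwards [hdiff] with t ht ht0
  obtain ⟨T, hT⟩ := exists_nat_gt t
  have hd : HasDerivAt φ (deriv φ t) t :=
    ((ht T ⟨ht0.le, hT.le⟩).differentiableAt (Icc_mem_nhds ht0 hT)).hasDerivAt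
  refine ⟨_, Set.mem_iInter₂.2 fun δ hδ => ?_, hd⟩
  have hslope : Tendsto (slope φ t) (𝓝[>] t) (𝓝 (deriv φ t)) :=
    tendsto_nhdsWithin_mono_left (fun x hx => (ne_of_gt hx : x ≠ t)) hd.tendsto_slope
  refine isClosed_closure.mem_of_tendsto hslope ?_
  set M := c * (1 + R T)
  -- Up to time `t'` the Euler nodes stay within `δ` of `φ t`: they move at speed at most `M`, and
  -- the node preceding time `t` is close to `φ t`.
  have hMpos : 0 < M + 1 := by have := hM0 T; linarith
  have hclose : ∀ᶠ t' in 𝓝[>] t, t' < (T : ℝ) ∧ t' < t + δ / (3 * (M + 1)) := by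
    refine mem_nhdsWithin_of_mem_nhds (Filter.inter_mem (Iio_mem_nhds hT) (Iio_mem_nhds ?_))
    linarith [show 0 < δ / (3 * (M + 1)) by positivity]
  filter_upwards [hclose, self_mem_nhdsWithin] with t' ⟨ht'T, ht'δ⟩ htt'
  refine slope_mem_of_tendsto_euler hl hφ (convex_convexHull ℝ _).closure isClosed_closure
    ht0.le htt' ?_
  have hstep : ∀ᶠ N in (𝒰 : Filter ℕ), eulerStep N < δ / (3 * (M + 1)) :=
    hl (tendsto_eulerStep.eventually (gt_mem_nhds (by positivity)))
  filter_upwards [hstep, (hφ t).eventually (Metric.ball_mem_nhds (φ t) (by positivity : 0 < δ / 3))]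
    with N hN hball j hj
  obtain ⟨hpj, hjq⟩ := Finset.mem_Ico.1 hj
  refine subset_closure (subset_convexHull ℝ _ ⟨_, ?_, rfl⟩)
  have hmove := norm_eulerSeq_sub_le (X := X) (x₀ := x₀) (eulerStep_pos N).le hpj (M := M)
    fun i hi => hXbound T N i (Nat.cast_nonneg T)
      (((Finset.mem_Ico.1 hi).2.le.trans hjq.le).trans (eulerIndex_mono ht'T.le))
  have hjt : (j : ℝ) * eulerStep N ≤ t' :=
    (mul_le_mul_of_nonneg_right (by exact_mod_cast hjq.le) (eulerStep_pos N).le).trans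
      (eulerIndex_mul_le (ht0.le.trans (le_of_lt htt')))
  have hpt := lt_eulerIndex_mul (N := N) (t := t)
  have hlen : (j : ℝ) * eulerStep N - eulerIndex N t * eulerStep N ≤ 2 * (δ / (3 * (M + 1))) := by
    linarith
  have hmove' : ‖eulerSeq X (eulerStep N) x₀ j - eulerSeq X (eulerStep N) x₀ (eulerIndex N t)‖ ≤
      2 * (δ / 3) := by
    refine hmove.trans ((mul_le_mul_of_nonneg_right hlen (hM0 T)).trans ?_)
    have : 2 * (δ / (3 * (M + 1))) * M = 2 * (δ / 3) * (M / (M + 1)) := by field_simp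
    rw [this]
    refine mul_le_of_le_one_right (by positivity) ((div_le_one hMpos).2 (by linarith))
  rw [Metric.mem_closedBall]
  refine (dist_triangle _ (eulerSeq X (eulerStep N) x₀ (eulerIndex N t)) _).trans ?_
  rw [dist_eq_norm (eulerSeq X (eulerStep N) x₀ j)]
  have := Metric.mem_ball.1 hball
  linarith

end Euler

/-! ### Completeness of maximal solutions -/

section Complete

variable {E : Type*} [NormedAddCommGroup E] [InnerProductSpace ℝ E]

theorem lipschitzOnWith_of_isSolution {F : E → Set E} {I : Set ℝ} {φ : ℝ → E}
    (hφ : IsSolution F I φ) {M : ℝ≥0} (hM : ∀ t ∈ I, ∀ v ∈ F (φ t), ‖v‖ ≤ M) :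
    LipschitzOnWith M φ I := by
  have key : ∀ s ∈ I, ∀ t ∈ I, s ≤ t → ‖φ t - φ s‖ ≤ M * (t - s) := fun s hs t ht hst =>
    norm_sub_le_of_hasDerivAt_norm_le hst M.2 (hφ.absolutelyContinuous s hs t ht) (by
      filter_upwards [hφ.deriv_mem] with r hr hrm
      have hrI := hφ.ordConnected.out hs ht hrm
      obtain ⟨v, hv, hd⟩ := hr hrI
      exact ⟨v, hM r hrI v hv, hd⟩)
  refine LipschitzOnWith.of_dist_le_mul fun s hs t ht => ?_
  rcases le_total s t with h | h
  · rw [dist_comm, dist_eq_norm, Real.dist_eq, abs_sub_comm, abs_of_nonneg (sub_nonneg.2 h)]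
    exact key s hs t ht h
  · rw [dist_eq_norm, Real.dist_eq, abs_of_nonneg (sub_nonneg.2 h)]
    exact key t ht s hs h

/-- A bounded solution of the Krasovskii regularization of a vector field of linear growth which
is defined on a bounded interval can be continued, hence is not maximal. -/
theorem not_isMaximalSolution_of_bddAbove [FiniteDimensional ℝ E] {X : E → E} {c : ℝ} (hc : 0 ≤ c)
    (hX : ∀ y, ‖X y‖ ≤ c * (1 + ‖y‖)) {I : Set ℝ} {φ : ℝ → E} {R : ℝ} (hI : BddAbove I)
    (hR : ∀ t ∈ I, ‖φ t‖ ≤ R) : ¬ IsMaximalSolution (krasovskii X) I φ := by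
  rintro ⟨hφ, hmax⟩
  have hR0 : 0 ≤ R := (norm_nonneg _).trans (hR 0 hφ.zero_mem)
  have hM0 : 0 ≤ c * (1 + R) := by positivity
  have hLip : LipschitzOnWith (c * (1 + R)).toNNReal φ I :=
    lipschitzOnWith_of_isSolution hφ fun t ht v hv => by
      rw [Real.coe_toNNReal _ hM0]
      exact (norm_le_of_mem_krasovskii hX hv).trans (by gcongr; exact hR t ht)
  obtain ⟨g, hg, hgφ⟩ := hLip.extend_finite_dimension
  set b := sSup I
  have hIb : ∀ t ∈ I, t ≤ b := fun t ht => le_csSup hI ht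
  have hb0 : 0 ≤ b := hIb 0 hφ.zero_mem
  obtain ⟨y, hy0, hyLip, hyd⟩ := exists_krasovskii_solution hc hX (g b)
  -- The Lipschitz extension `g` up to time `b`, continued from `g b` by a global solution; this
  -- closed form makes Lipschitz continuity across `b` immediate.
  set ψ : ℝ → E := fun t => g (min t b) + y (max (t - b) 0) - y 0 with hψ
  have hψ_left : ∀ t ≤ b, ψ t = g t := fun t ht => by
    simp [hψ, min_eq_left ht, max_eq_right (sub_nonpos.2 ht)]
  have hψ_right : ∀ t, b ≤ t → ψ t = y (t - b) := fun t ht => by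
    simp [hψ, min_eq_right ht, max_eq_left (sub_nonneg.2 ht), hy0]
  refine hmax ⟨Set.Ici 0, ψ, ⟨Set.ordConnected_Ici, subset_rfl, Set.self_mem_Ici, ?_, ?_⟩, ?_, ?_⟩
  · intro s hs t ht
    obtain ⟨C, hC⟩ := hyLip (max s t)
    have h1 : LipschitzWith 1 fun r : ℝ => min r b := LipschitzWith.id.min_const b
    have h2 : LipschitzWith 1 fun r : ℝ => max (r - b) 0 :=
      LipschitzWith.max_const (by
        simpa [sub_eq_add_neg] using LipschitzWith.of_dist_le_mul (K := 1)
          (f := fun r : ℝ => r + -b) (by simp)) 0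
    have h3 : LipschitzOnWith (C * 1) (fun r => y (max (r - b) 0)) (Set.uIcc s t) :=
      hC.comp h2.lipschitzOnWith fun r hr =>
        ⟨le_max_right _ _, max_le (by linarith [hr.2, hb0, show r ≤ max s t from hr.2])
          (le_max_of_le_left hs)⟩
    exact (((hg.comp h1).lipschitzOnWith.add h3).sub
      (LipschitzWith.const (y 0)).lipschitzOnWith).absolutelyContinuousOnInterval
  · have hshift : ∀ᵐ t, 0 < t - b → ∃ v ∈ krasovskii X (y (t - b)), HasDerivAt y v (t - b) :=
      (measurePreserving_sub_right volume b).quasiMeasurePreserving.ae hyd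
    have hne : ∀ a : ℝ, ∀ᵐ t, t ≠ a := fun a => by simp [ae_iff, measure_singleton]
    filter_upwards [hφ.deriv_mem, hshift, hne 0, hne b] with t h1 h2 ht0 htb ht
    have htpos : 0 < t := lt_of_le_of_ne ht (Ne.symm ht0)
    rcases lt_or_gt_of_ne htb with hlt | hgt
    · obtain ⟨a, haI, hta⟩ := exists_lt_of_lt_csSup ⟨0, hφ.zero_mem⟩ hlt
      have hsub : Set.Icc 0 a ⊆ I := hφ.ordConnected.out hφ.zero_mem haI
      obtain ⟨v, hv, hd⟩ := h1 (hsub ⟨ht, hta.le⟩)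
      have heq : ψ =ᶠ[𝓝 t] φ := by
        filter_upwards [Icc_mem_nhds htpos hta] with r hr
        rw [hψ_left r (hIb r (hsub hr)), hgφ (hsub hr)]
      exact ⟨v, by rwa [heq.eq_of_nhds], hd.congr_of_eventuallyEq heq⟩
    · obtain ⟨v, hv, hd⟩ := h2 (sub_pos.2 hgt)
      have heq : ψ =ᶠ[𝓝 t] fun r => y (r - b) := by
        filter_upwards [Ici_mem_nhds hgt] with r hr using hψ_right r hr
      exact ⟨v, by rwa [heq.eq_of_nhds], (hd.comp_sub_const t b).congr_of_eventuallyEq heq⟩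
  · refine Set.ssubset_iff_subset_ne.2 ⟨hφ.subset_nonneg, fun h => ?_⟩
    exact not_bddAbove_Ici (0 : ℝ) (h ▸ hI)
  · intro t ht
    rw [hψ_left t (hIb t ht), hgφ ht]

end Complete

/-! ### Stability of the unit ball of a seminorm -/

section Stability

variable {E : Type*} [NormedAddCommGroup E] [InnerProductSpace ℝ E]

/-- The gain `‖L‖ + 1` is used in place of `‖L‖` because it is always positive. -/
theorem norm_map_sub_one_le_infDist (L : E →L[ℝ] E) (x : E) :
    ‖L x‖ - 1 ≤ (‖L‖ + 1) * Metric.infDist x {x | ‖L x‖ ≤ 1} := by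
  have hpos : 0 < ‖L‖ + 1 := by positivity
  rw [← div_le_iff₀' hpos, Metric.le_infDist ⟨0, by simp⟩]
  intro y hy
  rw [div_le_iff₀' hpos]
  have h1 : ‖L x‖ - ‖L y‖ ≤ ‖L (x - y)‖ := by
    rw [map_sub]; exact norm_sub_norm_le _ _
  have h2 := L.le_opNorm (x - y)
  rw [dist_eq_norm]
  have hy' : ‖L y‖ ≤ 1 := hy
  nlinarith [norm_nonneg (x - y)]

/-- A point outside the unit ball of `‖L ·‖` is compared with its radial projection. -/
theorem infDist_le_norm_map_sub_one {L : E →L[ℝ] E} {κ : ℝ≥0} (hL : AntilipschitzWith κ L) (x : E) :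
    Metric.infDist x {x | ‖L x‖ ≤ 1} ≤ κ * max (‖L x‖ - 1) 0 := by
  rcases le_or_gt ‖L x‖ 1 with h | h
  · rw [Metric.infDist_zero_of_mem (show x ∈ {x | ‖L x‖ ≤ 1} from h)]
    positivity
  · have h0 : 0 < ‖L x‖ := by linarith
    have hmem : ‖L x‖⁻¹ • x ∈ {x | ‖L x‖ ≤ 1} := by
      simp [norm_smul, inv_mul_cancel₀ h0.ne']
    refine (Metric.infDist_le_dist_of_mem hmem).trans ((hL.le_mul_dist _ _).trans ?_)
    refine mul_le_mul_of_nonneg_left (le_max_of_le_left (le_of_eq ?_)) κ.2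
    have h1 : L x - L (‖L x‖⁻¹ • x) = (1 - ‖L x‖⁻¹) • L x := by
      rw [map_smul, sub_smul, one_smul]
    rw [dist_eq_norm, h1, norm_smul,
      Real.norm_of_nonneg (sub_nonneg.2 (inv_le_one_of_one_le₀ h.le)), sub_mul, inv_mul_cancel₀ h0.ne', one_mul]

/-- Solutions starting in the unit ball of `‖L ·‖` stay there; along the others `‖L φ‖` never
exceeds its initial value. -/
theorem norm_map_le_of_isSolution {F : E → Set E} {τ : ℝ} (hτ : 0 < τ) (L : E →L[ℝ] E)
    (hF : ∀ x, ∀ v ∈ F x, 2 * ⟪L x, L v⟫ ≤ τ * (1 - ‖L x‖ ^ 2))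
    {I : Set ℝ} {φ : ℝ → E} (hφ : IsSolution F I φ) {t : ℝ} (ht : t ∈ I) :
    ‖L (φ t)‖ ≤ max ‖L (φ 0)‖ 1 := by
  rcases le_or_gt ‖L (φ t)‖ 1 with h | h
  · exact le_max_of_le_right h
  · refine le_max_of_le_left ?_
    -- As `‖L (φ t)‖ > 1`, the exponential factor in the decay estimate may be dropped.
    have h1 := exp_mul_le_of_isSolution L hF hφ ht
    have h2 : 1 ≤ Real.exp (τ * t) :=
      Real.one_le_exp (mul_nonneg hτ.le (hφ.subset_nonneg ht))
    have h3 : 1 ≤ ‖L (φ t)‖ ^ 2 := one_le_pow₀ h.le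
    have h4 : ‖L (φ t)‖ ^ 2 ≤ ‖L (φ 0)‖ ^ 2 := by nlinarith
    exact le_of_sq_le_sq h4 (norm_nonneg _)

/-- If `‖L x‖²` satisfies the dissipation inequality with the vector field `X` of linear growth,
then the unit ball of `‖L ·‖` is asymptotically stable for the Krasovskii regularization of `X`. -/
theorem ugas_krasovskii_of_dissipation [FiniteDimensional ℝ E] {X : E → E} {c τ : ℝ} (hc : 0 ≤ c)
    (hτ : 0 < τ) (L : E →L[ℝ] E) (hker : LinearMap.ker L.toLinearMap = ⊥)
    (hX : ∀ y, ‖X y‖ ≤ c * (1 + ‖y‖))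
    (hL : ∀ y, 2 * ⟪L y, L (X y)⟫ ≤ τ * (1 - ‖L y‖ ^ 2)) :
    UGAS (krasovskii X) {x | ‖L x‖ ≤ 1} := by
  have : CompleteSpace E := FiniteDimensional.complete ℝ E
  obtain ⟨κ, hκ, hanti⟩ := L.toLinearMap.exists_antilipschitzWith hker
  have hF : ∀ x, ∀ v ∈ krasovskii X x, 2 * ⟪L x, L v⟫ ≤ τ * (1 - ‖L x‖ ^ 2) := fun x v hv =>
    inner_map_le_of_mem_krasovskii L hX hL hv
  set D := ‖L‖ + 1 with hD
  have hDpos : 0 < D := by positivity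
  have hκ' : (0 : ℝ) < κ := hκ
  refine ⟨⟨fun s => κ * (D * s), ⟨by fun_prop, by simp, ?_, fun M => ?_⟩, ?_⟩, ?_, ?_⟩
  · intro s _ t _ hst
    dsimp only
    gcongr
  · refine ⟨|M| / (κ * D), by positivity, ?_⟩
    have : (κ : ℝ) * (D * (|M| / (κ * D))) = |M| := by field_simp
    rw [this]
    exact le_abs_self M
  · intro I φ hφ t ht
    refine (infDist_le_norm_map_sub_one hanti _).trans (mul_le_mul_of_nonneg_left ?_ hκ'.le)
    have h1 := norm_map_le_of_isSolution hτ L hF hφ ht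
    have h2 := norm_map_sub_one_le_infDist L (φ 0)
    have h3 : 0 ≤ D * Metric.infDist (φ 0) {x | ‖L x‖ ≤ 1} :=
      mul_nonneg hDpos.le Metric.infDist_nonneg
    refine max_le ?_ h3
    rcases le_max_iff.1 h1 with h | h <;> linarith
  · intro I φ hφ hI
    refine not_isMaximalSolution_of_bddAbove (R := κ * max ‖L (φ 0)‖ 1) hc hX hI
      (fun t ht => ?_) hφ
    have h1 := hanti.le_mul_dist (φ t) 0
    simp only [map_zero, dist_zero_right] at h1
    exact h1.trans (mul_le_mul_of_nonneg_left (norm_map_le_of_isSolution hτ L hF hφ.1 ht) hκ'.le)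
  · intro ε hε μ hμ
    set Q := κ * (1 + D * μ) ^ 2 with hQ
    have hQpos : 0 < Q := by positivity
    -- At this time `exp (τ t) ≥ τ t ≥ Q / ε`.
    refine ⟨Q / ε / τ, by positivity, fun I φ hφ hμφ t ht hTt => ?_⟩
    refine (infDist_le_norm_map_sub_one hanti _).trans ?_
    rcases le_or_gt ‖L (φ t)‖ 1 with h | h
    · rw [max_eq_right (by linarith), mul_zero]
      exact hε.le
    rw [max_eq_left (by linarith)]
    have h1 := exp_mul_le_of_isSolution L hF hφ ht
    have h2 : ‖L (φ 0)‖ ≤ 1 + D * μ := by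
      have := norm_map_sub_one_le_infDist L (φ 0)
      have := mul_le_mul_of_nonneg_left hμφ hDpos.le
      linarith
    have h3 : ‖L (φ 0)‖ ^ 2 ≤ (1 + D * μ) ^ 2 := by gcongr
    have h4 : Q / ε ≤ Real.exp (τ * t) := by
      rw [div_le_iff₀ hτ] at hTt
      linarith [Real.add_one_le_exp (τ * t)]
    have h5 : Real.exp (τ * t) * (‖L (φ t)‖ - 1) ≤ (1 + D * μ) ^ 2 := by
      have : ‖L (φ t)‖ - 1 ≤ ‖L (φ t)‖ ^ 2 - 1 := by nlinarith
      have := mul_le_mul_of_nonneg_left this (Real.exp_pos (τ * t)).le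
      linarith
    have h6 : Q / ε * (κ * (‖L (φ t)‖ - 1)) ≤ Q := by
      have h7 : 0 ≤ (κ : ℝ) * (‖L (φ t)‖ - 1) := mul_nonneg hκ'.le (by linarith)
      calc Q / ε * (κ * (‖L (φ t)‖ - 1)) ≤ Real.exp (τ * t) * (κ * (‖L (φ t)‖ - 1)) := by gcongr
        _ = κ * (Real.exp (τ * t) * (‖L (φ t)‖ - 1)) := by ring
        _ ≤ Q := by rw [hQ]; gcongr
    rw [div_mul_eq_mul_div, div_le_iff₀ hε] at h6
    exact le_of_mul_le_mul_left h6 hQpos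

end Stability

/-! ### The quantizer and the matrix inequality -/

section Quantizer

open Matrix

variable {n m : ℕ}

open scoped MatrixOrder Matrix.Norms.L2Operator in
theorem exists_eq_transpose_mul_self_of_posSemidef {n : ℕ} {P : Matrix (Fin n) (Fin n) ℝ}
    (hP : P.PosSemidef) : ∃ Q : Matrix (Fin n) (Fin n) ℝ, P = Qᵀ * Q :=
  CStarAlgebra.nonneg_iff_eq_star_mul_self.mp hP.nonneg

/-- The two sector conditions on the quantization error: it is bounded by the quantization step, and
the quantized value lies between `0` and the true value. -/
theorem quantizationError_sector {δ : Fin n → ℝ} (hδ : ∀ i, 0 < δ i) (x : EuclideanSpace ℝ (Fin n))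
    (i : Fin n) : |quantizationError δ x i| ≤ δ i ∧
      quantizationError δ x i * (quantizationError δ x i + x i) ≤ 0 := by
  have h1 := Int.floor_le (|x i| / δ i)
  have h2 := Int.lt_floor_add_one (|x i| / δ i)
  have h3 : (0 : ℝ) ≤ ⌊|x i| / δ i⌋ := by
    exact_mod_cast Int.floor_nonneg.2 (div_nonneg (abs_nonneg _) (hδ i).le)
  rw [le_div_iff₀ (hδ i)] at h1
  rw [div_lt_iff₀ (hδ i)] at h2
  have hq : quantizationError δ x i = δ i * Real.sign (x i) * (⌊|x i| / δ i⌋ : ℝ) - x i := rfl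
  have h0 := hδ i
  rw [hq]
  generalize (⌊|x i| / δ i⌋ : ℝ) = k at *
  rcases lt_trichotomy (x i) 0 with hx | hx | hx
  · rw [Real.sign_of_neg hx]
    rw [abs_of_neg hx] at h1 h2
    refine ⟨abs_le.2 ⟨by linarith, by linarith⟩, ?_⟩
    nlinarith [mul_nonneg h3 h0.le]
  · simp [hx, h0.le]
  · rw [Real.sign_of_pos hx]
    rw [abs_of_pos hx] at h1 h2
    refine ⟨abs_le.2 ⟨by linarith, by linarith⟩, ?_⟩
    nlinarith [mul_nonneg h3 h0.le]

theorem quantizationError_norm_le {δ : Fin n → ℝ} (hδ : ∀ i, 0 < δ i)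
    (x : EuclideanSpace ℝ (Fin n)) :
    ‖quantizationError δ x‖ ≤ ‖(WithLp.toLp 2 δ : EuclideanSpace ℝ (Fin n))‖ := by
  rw [EuclideanSpace.norm_eq, EuclideanSpace.norm_eq]
  refine Real.sqrt_le_sqrt (Finset.sum_le_sum fun i _ => ?_)
  rw [Real.norm_eq_abs, Real.norm_eq_abs]
  exact pow_le_pow_left₀ (abs_nonneg _)
    ((quantizationError_sector hδ x i).1.trans (le_abs_self _)) 2

theorem dotProduct_mulVec_of_isDiag {S : Matrix (Fin n) (Fin n) ℝ} (hS : S.IsDiag)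
    (u v : Fin n → ℝ) : u ⬝ᵥ S *ᵥ v = ∑ i, S i i * (u i * v i) := by
  conv_lhs => rw [← hS.diagonal_diag]
  simp only [dotProduct, mulVec_diagonal, diag_apply]
  exact Finset.sum_congr rfl fun i _ => by ring

variable {A : Matrix (Fin n) (Fin n) ℝ} {B : Matrix (Fin n) (Fin m) ℝ}
  {K : Matrix (Fin m) (Fin n) ℝ} {P S₁ S₂ : Matrix (Fin n) (Fin n) ℝ} {τ : ℝ}

/-- The quadratic form of the block matrix, in terms of the vector `(A + BK) x + BK ψ`. -/
theorem dotProduct_lmiMatrix_mulVec (hS₂ : S₂ᵀ = S₂) (x ψ : Fin n → ℝ) :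
    Sum.elim x ψ ⬝ᵥ lmiMatrix A B K P S₁ S₂ τ *ᵥ Sum.elim x ψ =
      2 * (x ⬝ᵥ P *ᵥ ((A + B * K) *ᵥ x + (B * K) *ᵥ ψ)) + τ * (x ⬝ᵥ P *ᵥ x)
        - ψ ⬝ᵥ S₁ *ᵥ ψ - 2 * (ψ ⬝ᵥ S₂ *ᵥ (ψ + x)) := by
  have hT : ∀ (M : Matrix (Fin n) (Fin n) ℝ) (u v : Fin n → ℝ),
      u ⬝ᵥ Mᵀ *ᵥ v = v ⬝ᵥ M *ᵥ u := fun M u v => by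
    rw [dotProduct_mulVec, vecMul_transpose, dotProduct_comm]
  rw [lmiMatrix, fromBlocks_mulVec, Sum.elim_comp_inl, Sum.elim_comp_inr,
    sumElim_dotProduct_sumElim, He]
  simp only [add_mulVec, sub_mulVec, neg_mulVec, smul_mulVec, dotProduct_add, dotProduct_sub,
    dotProduct_neg, dotProduct_smul, smul_eq_mul, hT, mulVec_add, Matrix.mul_add, mulVec_mulVec,
    Matrix.mul_assoc]
  rw [← hT S₂ x ψ, hS₂]
  ring

/-- Adding the sector conditions, weighted by `S₁` and `S₂`, to the matrix inequality. -/
theorem dissipation_of_lmi {δ : Fin n → ℝ} (hδ : ∀ i, 0 < δ i)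
    (hS₁ : S₁.PosDef) (hS₁_diag : S₁.IsDiag)
    (hS₂ : S₂.PosDef) (hS₂_diag : S₂.IsDiag)
    (hLMI : (-lmiMatrix A B K P S₁ S₂ τ).PosDef) (hΔ : δ ⬝ᵥ S₁ *ᵥ δ - τ ≤ 0)
    (x : EuclideanSpace ℝ (Fin n)) :
    2 * (x.ofLp ⬝ᵥ P *ᵥ (closedLoop A B K δ x).ofLp) ≤ τ * (1 - x.ofLp ⬝ᵥ P *ᵥ x.ofLp) := by
  set ψ := quantizationError δ x
  have h0 := hLMI.posSemidef.dotProduct_mulVec_nonneg (Sum.elim x.ofLp ψ.ofLp)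
  rw [star_trivial, neg_mulVec, dotProduct_neg,
    dotProduct_lmiMatrix_mulVec hS₂_diag.isSymm] at h0
  have h1 : ψ.ofLp ⬝ᵥ S₁ *ᵥ ψ.ofLp ≤ δ ⬝ᵥ S₁ *ᵥ δ := by
    rw [dotProduct_mulVec_of_isDiag hS₁_diag, dotProduct_mulVec_of_isDiag hS₁_diag]
    refine Finset.sum_le_sum fun i _ => mul_le_mul_of_nonneg_left ?_ hS₁.diag_pos.le
    rw [← abs_mul_abs_self]
    have := (quantizationError_sector hδ x i).1
    exact mul_le_mul this this (abs_nonneg _) (hδ i).le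
  have h2 : ψ.ofLp ⬝ᵥ S₂ *ᵥ (ψ.ofLp + x.ofLp) ≤ 0 := by
    rw [dotProduct_mulVec_of_isDiag hS₂_diag]
    exact Finset.sum_nonpos fun i _ => mul_nonpos_of_nonneg_of_nonpos hS₂.diag_pos.le
      (quantizationError_sector hδ x i).2
  have h3 : (closedLoop A B K δ x).ofLp = (A + B * K) *ᵥ x.ofLp + (B * K) *ᵥ ψ.ofLp := rfl
  rw [h3]
  linarith

theorem exists_closedLoop_norm_le (A : Matrix (Fin n) (Fin n) ℝ) (B : Matrix (Fin n) (Fin m) ℝ)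
    (K : Matrix (Fin m) (Fin n) ℝ) {δ : Fin n → ℝ} (hδ : ∀ i, 0 < δ i) :
    ∃ c, 0 ≤ c ∧ ∀ x, ‖closedLoop A B K δ x‖ ≤ c * (1 + ‖x‖) := by
  set M₁ := (toEuclideanLin (A + B * K)).toContinuousLinearMap
  set M₂ := (toEuclideanLin (B * K)).toContinuousLinearMap
  set D := ‖(WithLp.toLp 2 δ : EuclideanSpace ℝ (Fin n))‖
  refine ⟨‖M₁‖ + ‖M₂‖ * D, by positivity, fun x => ?_⟩
  have h1 : ‖closedLoop A B K δ x‖ ≤ ‖M₁‖ * ‖x‖ + ‖M₂‖ * D :=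
    (norm_add_le _ _).trans (add_le_add (M₁.le_opNorm x) ((M₂.le_opNorm _).trans
      (mul_le_mul_of_nonneg_left (quantizationError_norm_le hδ x) (norm_nonneg _))))
  have h2 : 0 ≤ ‖M₁‖ + ‖M₂‖ * D * ‖x‖ := by positivity
  linarith

end Quantizer

end QuantizedControl

theorem mainTheorem1 (n m : ℕ)
    (A : Matrix (Fin n) (Fin n) ℝ) (B : Matrix (Fin n) (Fin m) ℝ) (K : Matrix (Fin m) (Fin n) ℝ)
    (δ : Fin n → ℝ) (hδ : ∀ i, 0 < δ i)
    (P S₁ S₂ : Matrix (Fin n) (Fin n) ℝ) (τ : ℝ)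
    (hP : P.PosDef)
    (hS₁ : S₁.PosDef) (hS₁_diag : S₁.IsDiag)
    (hS₂ : S₂.PosDef) (hS₂_diag : S₂.IsDiag)
    (hτ : 0 < τ)
    (hLMI : (-QuantizedControl.lmiMatrix A B K P S₁ S₂ τ).PosDef)
    (hΔ : δ ⬝ᵥ S₁.mulVec δ - τ ≤ 0) :
    IsCompact (QuantizedControl.ellipsoid P) ∧
    (0 : EuclideanSpace ℝ (Fin n)) ∈ QuantizedControl.ellipsoid P ∧
    QuantizedControl.UGAS
      (QuantizedControl.krasovskii (QuantizedControl.closedLoop A B K δ))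
      (QuantizedControl.ellipsoid P) := by
  obtain ⟨Q, hQ⟩ := QuantizedControl.exists_eq_transpose_mul_self_of_posSemidef hP.posSemidef
  set L := (Matrix.toEuclideanLin Q).toContinuousLinearMap
  have hinner : ∀ x y, inner ℝ (L x) (L y) = x.ofLp ⬝ᵥ P.mulVec y.ofLp := fun x y => by
    have h1 : ∀ z, (L z).ofLp = Q.mulVec z.ofLp := fun _ => rfl
    rw [EuclideanSpace.inner_eq_star_dotProduct, star_trivial, h1, h1, hQ, dotProduct_comm,
      ← Matrix.mulVec_mulVec, Matrix.dotProduct_mulVec x.ofLp, Matrix.vecMul_transpose]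
  have hnorm : ∀ x, ‖L x‖ ^ 2 = x.ofLp ⬝ᵥ P.mulVec x.ofLp := fun x => by
    rw [← real_inner_self_eq_norm_sq, hinner]
  have hell : QuantizedControl.ellipsoid P = {x | ‖L x‖ ≤ 1} := by
    ext x
    rw [QuantizedControl.ellipsoid, Set.mem_ofPred_eq, Set.mem_ofPred_eq, ← hnorm,
      sq_le_one_iff₀ (norm_nonneg _)]
  have hker : LinearMap.ker L.toLinearMap = ⊥ := by
    refine LinearMap.ker_eq_bot'.2 fun x hx => ?_
    by_contra hne
    have h1 := hP.dotProduct_mulVec_pos (x := x.ofLp) (by simpa using hne)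
    have h2 : L x = 0 := hx
    rw [star_trivial, ← hnorm, h2] at h1
    simp at h1
  obtain ⟨c, hc, hX⟩ := QuantizedControl.exists_closedLoop_norm_le A B K hδ
  rw [hell]
  refine ⟨?_, by simp, QuantizedControl.ugas_krasovskii_of_dissipation hc hτ L hker hX fun y => ?_⟩
  · obtain ⟨κ, -, hanti⟩ := L.toLinearMap.exists_antilipschitzWith hker
    refine Metric.isCompact_of_isClosed_isBounded
      (isClosed_le (by fun_prop) continuous_const) ?_
    have := hanti.isBounded_preimage (Metric.isBounded_closedBall (x := 0) (r := 1))
    refine this.subset fun x hx => ?_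
    simpa using hx
  · rw [hinner, hnorm]
    exact QuantizedControl.dissipation_of_lmi hδ hS₁ hS₁_diag hS₂ hS₂_diag hLMI hΔ y
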